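/- Let $k$ be an algebraically closed field of characteristic zero, let $S$ be a scheme locally of finite type over $k$, and let $f\colon X\to S$ be a finite flat morphism of constant degree $d$ (so $X$ is also locally of finite type over $k$). Assume that $f$ is generically étale, i.e. there is a dense open subset $U\subseteq S$ such that $f^{-1}(U)\to U$ is étale. Consider the locus \[ \mathcal Z=\{\, s\in S \mid \text{the geometric fiber } X\times_S \operatorname{Spec}\overline{\kappa(s)} \text{ has exactly one point}\,\}. \] Then $\mathcal Z$ is a closed subset of $S$, and for every point $z\in\mathcal Z$ we have \[ \dim_z \mathcal Z\ \ge\ \dim_z S-(d-1), \] where $\dim_z T$ denotes the infimum of the Krull dimensions of the open neighbourhoods of $z$ in $T$. -/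

import Mathlib

open CategoryTheory CategoryTheory.Limits AlgebraicGeometry

universe u

/-- The local dimension `dim_x T` of a topological space `T` at a point `x`: the infimum of the
Krull dimensions of the open neighbourhoods of `x`. -/
noncomputable def localDim (T : Type*) [TopologicalSpace T] (x : T) : WithBot ℕ∞ :=
  ⨅ (U : TopologicalSpace.Opens T) (_ : x ∈ U), topologicalKrullDim U

/-- The geometric point `Spec Ω ⟶ S` over a point `s` of `S`, where `Ω` is the algebraic closure of
the residue field of `s`. -/
noncomputable def geometricPoint (S : Scheme.{u}) (s : S) :
    Spec (CommRingCat.of (AlgebraicClosure (S.residueField s))) ⟶ S :=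
  Spec.map (CommRingCat.ofHom
    (algebraMap (S.residueField s) (AlgebraicClosure (S.residueField s)))) ≫
    S.fromSpecResidueField s

/-- The geometric fiber of `f` at `s`: the base change of `f` to the algebraic closure of the
residue field of `s`. -/
noncomputable def geometricFiber {X S : Scheme.{u}} (f : X ⟶ S) (s : S) : Scheme.{u} :=
  pullback f (geometricPoint S s)

/-- The total branch locus of `f`: the points of the base whose geometric fiber has exactly one
point. -/
def totalBranchLocus {X S : Scheme.{u}} (f : X ⟶ S) : Set S :=
  {s | ∃ x : geometricFiber f s, ∀ y : geometricFiber f s, y = x}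

/-- `f : X ⟶ S` is generically étale: it is étale over some dense open subset of `S`. -/
def GenericallyEtale {X S : Scheme.{u}} (f : X ⟶ S) : Prop :=
  ∃ U : S.Opens, Dense (U : Set S) ∧ Etale (f ∣_ U)

/-!
The question is local on `S`, so let `S = Spec R` and `X = Spec A` with `A` finite flat over `R` of
rank `d`, and let `V(p)` be a component of `S`, or any irreducible closed subset, through a point
`q` of the branch locus.

Adjoin to `R ⧸ p` the values of all points of `A` in an algebraic closure of the residue field at
`p`. This gives a finite extension `D` of `R ⧸ p` over which `A` acquires at most `d` sections, and
by flatness these sections exhaust the spectrum of `D ⊗ A`: every prime of `D ⊗ A` specialises from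
a prime over the generic point (`exists_isSplitBy`). The branch locus therefore pulls back to the
closed set where all sections agree (`IsSplitBy.exists_forall_eq_iff_of_isIntegral`). As
`Spec D → V(p)` is finite, the branch locus is closed.

For the dimension, the sections are made to agree one after another, at the cost of one dimension
each time. Suppose that all sections agree at `q`, but not all of them agree everywhere. Normalise
the base. Then two sections agree along a prime of height one below `q`: otherwise the idempotent
that separates one section from all the others at the generic point would be regular at all primes
of height one below `q`, hence at `q` because the algebra is projective over a normal domain, but an
idempotent cannot separate sections that meet at `q` (`exists_height_le_one_forall_sub_mem`). Restrict to
that prime and repeat: after at most `d - 1` steps all sections agree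
(`IsSplitBy.exists_forall_sub_mem`). Finite morphisms preserve dimensions, and a prime of height one
in a domain of finite type over a field has codimension one
(`ringKrullDim_le_ringKrullDim_quotient_add_one_of_height_le_one`), so the image in `V(p)` is an
irreducible subset of the branch locus through `q` of codimension at most `d - 1`.
-/

/-! ### Krull dimension of algebras of finite type -/

theorem ringKrullDim_le_of_isIntegral (R S : Type*) [CommRing R] [CommRing S] [Algebra R S]
    [Algebra.IsIntegral R S] : ringKrullDim S ≤ ringKrullDim R :=
  Order.krullDim_le_of_strictMono (PrimeSpectrum.comap (algebraMap R S)) fun _ _ h ↦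
    Ideal.IsIntegral.comap_lt_comap (show _ < _ from h)

/-- Going up for chains of primes. The last member is tracked so that the chain can be prolonged. -/
theorem exists_ltSeries_last_of_isIntegral {R S : Type*} [CommRing R] [CommRing S] [Algebra R S]
    [Algebra.IsIntegral R S] (hinj : Function.Injective (algebraMap R S))
    (l : LTSeries (PrimeSpectrum R)) :
    ∃ L : LTSeries (PrimeSpectrum S), L.length = l.length ∧
      PrimeSpectrum.comap (algebraMap R S) L.last = l.last := by
  induction l using RelSeries.inductionOn' with
  | singleton p =>
    obtain ⟨Q, -, hQ, h⟩ := Ideal.exists_ideal_over_prime_of_isIntegral p.asIdeal (⊥ : Ideal S)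
      (by rw [← RingHom.ker_eq_comap_bot, (RingHom.injective_iff_ker_eq_bot _).mp hinj]; exact bot_le)
    exact ⟨RelSeries.singleton _ ⟨Q, hQ⟩, rfl, PrimeSpectrum.ext h⟩
  | snoc l p hp ih =>
    obtain ⟨L, hlen, hlast⟩ := ih
    have hp' : l.last < p := hp
    obtain ⟨Q, hle, hQ, h⟩ := Ideal.exists_ideal_over_prime_of_isIntegral_of_isPrime p.asIdeal
      L.last.asIdeal (S := S) (by
        have := congrArg PrimeSpectrum.asIdeal hlast
        simp only [PrimeSpectrum.comap_asIdeal] at this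
        rw [this]; exact hp'.le)
    have hlt : L.last < ⟨Q, hQ⟩ := by
      refine lt_of_le_of_ne hle fun e ↦ hp'.ne ?_
      rw [← hlast, e]
      exact PrimeSpectrum.ext h
    exact ⟨L.snoc ⟨Q, hQ⟩ hlt, by simp [hlen], by simpa using PrimeSpectrum.ext h⟩

theorem ringKrullDim_eq_of_isIntegral (R S : Type*) [CommRing R] [CommRing S] [Algebra R S]
    [Algebra.IsIntegral R S] (hinj : Function.Injective (algebraMap R S)) :
    ringKrullDim S = ringKrullDim R := by
  refine (ringKrullDim_le_of_isIntegral R S).antisymm (iSup_le fun l ↦ ?_)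
  obtain ⟨L, hL, -⟩ := exists_ltSeries_last_of_isIntegral (S := S) hinj l
  rw [← hL]
  exact Order.LTSeries.length_le_krullDim L

section FiniteType

variable (k : Type u) [Field k]

open Algebra Algebra.IsAlgebraic AlgebraicIndependent in
theorem trdeg_eq_of_isAlgebraic (R S : Type u) [CommRing R] [CommRing S] [IsDomain S] [Algebra k R]
    [Algebra k S] [Algebra R S] [IsScalarTower k R S] [Algebra.IsAlgebraic R S]
    (hinj : Function.Injective (algebraMap R S)) : Algebra.trdeg k S = Algebra.trdeg k R := by
  have := hinj.isDomain
  have := (faithfulSMul_iff_algebraMap_injective R S).mpr hinj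
  have : FaithfulSMul k R := (faithfulSMul_iff_algebraMap_injective k R).mpr
    (algebraMap k R).injective
  rw [← _root_.trdeg_add_eq k R (A := S), trdeg_eq_zero (R := R), add_zero]

/-- The Krull dimension of a domain of finite type over a field is its transcendence degree. -/
theorem ringKrullDim_eq_trdeg (D : Type u) [CommRing D] [IsDomain D] [Algebra k D]
    [Algebra.FiniteType k D] :
    ringKrullDim D = (Cardinal.toNat (Algebra.trdeg k D) : ℕ) := by
  obtain ⟨s, g, hg, hfin⟩ := exists_finite_inj_algHom_of_fg k D
  algebraize [g.toRingHom]
  have : IsScalarTower k (MvPolynomial (Fin s) k) D := .of_algHom g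
  have : Module.Finite (MvPolynomial (Fin s) k) D := hfin
  have hinj : Function.Injective (algebraMap (MvPolynomial (Fin s) k) D) := hg
  rw [ringKrullDim_eq_of_isIntegral (MvPolynomial (Fin s) k) D hinj,
    trdeg_eq_of_isAlgebraic k (MvPolynomial (Fin s) k) D hinj]
  simp [MvPolynomial.trdeg_of_isDomain]

theorem ringKrullDim_away (D D' : Type u) [CommRing D] [IsDomain D] [Algebra k D]
    [Algebra.FiniteType k D] [CommRing D'] [Algebra D D'] {h : D} (hh : h ≠ 0)
    [IsLocalization.Away h D'] : ringKrullDim D' = ringKrullDim D := by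
  have hle : Submonoid.powers h ≤ nonZeroDivisors D := powers_le_nonZeroDivisors_of_noZeroDivisors hh
  have := IsLocalization.isDomain_of_le_nonZeroDivisors (M := Submonoid.powers h) D' hle
  let : Algebra k D' := ((algebraMap D D').comp (algebraMap k D)).toAlgebra
  have : IsScalarTower k D D' := .of_algebraMap_eq fun _ ↦ rfl
  have : Algebra.FiniteType D D' := IsLocalization.finiteType_of_monoid_fg (Submonoid.powers h) D'
  have : Algebra.FiniteType k D' := Algebra.FiniteType.trans ‹Algebra.FiniteType k D› this
  have : Algebra.IsAlgebraic D D' := IsLocalization.isAlgebraic D' (Submonoid.powers h)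
  rw [ringKrullDim_eq_trdeg k D', ringKrullDim_eq_trdeg k D,
    trdeg_eq_of_isAlgebraic k D D' (IsLocalization.injective D' hle)]

/-- The variables other than a given one occurring in `f` stay algebraically independent modulo
`f`. -/
theorem le_trdeg_quotient_span_singleton {s : ℕ} {f : MvPolynomial (Fin (s + 1)) k} (hf : f ≠ 0)
    (i : Fin (s + 1)) (hi : i ∈ f.vars) :
    (s : Cardinal) ≤ Algebra.trdeg k (MvPolynomial (Fin (s + 1)) k ⧸ Ideal.span {f}) := by
  have hind : AlgebraicIndependent k (fun j : Fin s ↦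
      (Ideal.Quotient.mkₐ k (Ideal.span {f}) (MvPolynomial.X (i.succAbove j)))) := by
    rw [algebraicIndependent_iff_injective_aeval, injective_iff_map_eq_zero]
    intro p hp
    have hp' : MvPolynomial.rename i.succAbove p ∈ Ideal.span {f} := by
      rw [← Ideal.Quotient.eq_zero_iff_mem, ← hp]
      have : ((Ideal.Quotient.mkₐ k (Ideal.span {f})).comp (MvPolynomial.rename i.succAbove)) p =
          MvPolynomial.aeval (fun j ↦
            (Ideal.Quotient.mkₐ k (Ideal.span {f}) (MvPolynomial.X (i.succAbove j)))) p := by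
        congr 1
        ext j
        simp
      exact this
    obtain ⟨g, hg⟩ := Ideal.mem_span_singleton.mp hp'
    by_contra hp0
    have hne : MvPolynomial.rename i.succAbove p ≠ 0 := by
      rwa [Ne, MvPolynomial.rename_eq_zero_iff_of_injective]
      exact Fin.succAbove_right_injective
    have hg0 : g ≠ 0 := by
      rintro rfl
      exact hne (by simpa using hg)
    have h1 := MvPolynomial.degreeOf_mul_eq (n := i) hf hg0
    rw [← hg] at h1
    have h2 : MvPolynomial.degreeOf i (MvPolynomial.rename i.succAbove p) = 0 := by
      by_contra h
      have : i ∈ (MvPolynomial.rename i.succAbove p).vars := by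
        rw [MvPolynomial.mem_vars_iff_degreeOf_ne_zero]; exact h
      have := MvPolynomial.vars_rename _ _ this
      simp [Fin.succAbove_ne] at this
    have h3 : MvPolynomial.degreeOf i f ≠ 0 := by
      rwa [← MvPolynomial.mem_vars_iff_degreeOf_ne_zero]
    omega
  have := hind.lift_cardinalMk_le_trdeg
  simpa using this

/-- In a domain of finite type over a field, a prime of height one has codimension one: it
contracts to a principal prime of a Noether normalization. -/
theorem ringKrullDim_le_ringKrullDim_quotient_add_one_of_height_le_one (N : Type u) [CommRing N]
    [IsDomain N] [Algebra k N] [Algebra.FiniteType k N] (p : Ideal N) [p.IsPrime]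
    (hp : p.height ≤ 1) : ringKrullDim N ≤ ringKrullDim (N ⧸ p) + 1 := by
  by_cases hp0 : p = ⊥
  · subst hp0
    rw [ringKrullDim_eq_of_ringEquiv (RingEquiv.quotientBot N)]
    exact le_add_of_nonneg_right zero_le_one
  obtain ⟨s, g, hg, hfin⟩ := exists_finite_inj_algHom_of_fg k N
  algebraize [g.toRingHom]
  set B := MvPolynomial (Fin s) k with hB
  have : IsScalarTower k B N := .of_algHom g
  have : Module.Finite B N := hfin
  have hinj : Function.Injective (algebraMap B N) := hg
  have := (faithfulSMul_iff_algebraMap_injective B N).mpr hinj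
  have hP0 : p.under B ≠ ⊥ := Ideal.under_ne_bot B hp0
  obtain ⟨f, hfp, hf⟩ := Ideal.IsPrime.exists_mem_prime_of_ne_bot (inferInstance : (p.under B).IsPrime)
    hP0
  have hfprime : (Ideal.span {f}).IsPrime := (Ideal.span_singleton_prime hf.ne_zero).mpr hf
  -- by going down, a prime of height at most one contracts to a principal ideal
  obtain ⟨Q, hQp, hQ, hQf⟩ := Ideal.exists_ideal_le_liesOver_of_le (q := p.under B) p
    ((Ideal.span_singleton_le_iff_mem _).mpr hfp)
  have hQ0 : Q ≠ ⊥ := by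
    rintro rfl
    have h1 : Ideal.span {f} = (⊥ : Ideal N).under B := hQf.over
    have h2 : f ∈ (⊥ : Ideal N).under B := h1 ▸ Ideal.mem_span_singleton_self f
    exact hf.ne_zero (hinj (by simpa using h2))
  obtain rfl : Q = p := by
    by_contra hne
    have h1 := Ideal.height_add_one_le_of_lt_of_isPrime (lt_of_le_of_ne hQp hne)
    have h2 : Q.height ≠ 0 := fun h ↦ hQ0 (Ideal.height_eq_zero_iff_eq_bot.mp h)
    have h3 : 1 ≤ Q.height := Order.one_le_iff_ne_zero.mpr h2
    have h4 : (1 : ℕ∞) + 1 ≤ 1 := (add_le_add_left h3 1).trans (h1.trans hp)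
    exact absurd h4 (by decide)
  have hle : ringKrullDim (B ⧸ Ideal.span {f}) ≤ ringKrullDim (N ⧸ Q) :=
    (ringKrullDim_eq_of_isIntegral (B ⧸ Ideal.span {f}) (N ⧸ Q)
      (FaithfulSMul.algebraMap_injective _ _)).ge
  refine le_trans ?_ (add_le_add_left hle 1)
  rw [ringKrullDim_eq_of_isIntegral B N hinj, ringKrullDim_eq_trdeg k (B ⧸ Ideal.span {f})]
  have hvars : f.vars.Nonempty := by
    rw [Finset.nonempty_iff_ne_empty]
    intro h
    obtain ⟨c, hc⟩ : ∃ c, MvPolynomial.C c = f := ⟨_, (MvPolynomial.vars_eq_empty_iff_eq_C.mp h).symm⟩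
    have hc0 : c ≠ 0 := by
      rintro rfl
      exact hf.ne_zero (by simp [← hc])
    exact hf.not_isUnit (hc ▸ (IsUnit.mk0 c hc0).map MvPolynomial.C)
  obtain ⟨i, hi⟩ := hvars
  obtain _ | s := s
  · exact i.elim0
  have h1 := le_trdeg_quotient_span_singleton k hf.ne_zero i hi
  have h2 : Algebra.trdeg k (B ⧸ Ideal.span {f}) < Cardinal.aleph0 := trdeg_lt_aleph0_of_finiteType
  have h3 : s ≤ Cardinal.toNat (Algebra.trdeg k (B ⧸ Ideal.span {f})) := by
    simpa using Cardinal.toNat_le_toNat h1 h2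
  refine (MvPolynomial.ringKrullDim_of_isNoetherianRing (R := k) (ι := Fin (s + 1))).trans_le ?_
  simp only [ringKrullDim_eq_zero_of_field, zero_add, Nat.card_eq_fintype_card, Fintype.card_fin]
  exact_mod_cast Nat.succ_le_succ h3

end FiniteType

/-! ### Height one primes of Noetherian normal domains -/

section Normal

variable {N : Type*} [CommRing N] [IsDomain N] [IsNoetherianRing N]

/-- In a Noetherian normal domain, a prime of the form `(s) : w` has height at most one. -/
theorem height_le_one_of_colon_isPrime [IsIntegrallyClosed N] {p : Ideal N} [hp : p.IsPrime] {s w : N}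
    (hs : s ≠ 0) (h : ∀ t, t ∈ p ↔ s ∣ t * w) : p.height ≤ 1 := by
  -- either multiplication by `w / s` preserves `p`, so that `w / s` is integral, or `p` becomes
  -- principal after localising at `p`
  by_cases hcase : ∀ t ∈ p, ∀ v, t * w = s * v → v ∈ p
  · exfalso
    let K := FractionRing N
    have hs' : algebraMap N K s ≠ 0 := by simpa using hs
    have hint : IsIntegral N (algebraMap N K w / algebraMap N K s) := by
      refine isIntegral_of_smul_mem_submodule (Submodule.map (Algebra.linearMap N K) p) ?_
        ((IsNoetherian.noetherian p).map _) _ ?_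
      · intro h0
        have : algebraMap N K s ∈ Submodule.map (Algebra.linearMap N K) p :=
          Submodule.mem_map_of_mem ((h s).mpr (dvd_mul_right s w))
        rw [h0] at this
        exact hs' (by simpa using this)
      · rintro _ ⟨t, ht, rfl⟩
        obtain ⟨v, hv⟩ := (h t).mp ht
        refine ⟨v, hcase t ht v hv, ?_⟩
        have := congrArg (algebraMap N K) hv
        simp only [map_mul] at this
        simp only [Algebra.linearMap_apply, smul_eq_mul]
        rw [div_mul_eq_mul_div, eq_div_iff hs']
        linear_combination -this
    obtain ⟨x, hx⟩ := IsIntegrallyClosed.isIntegral_iff.mp hint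
    refine hp.ne_top ((Ideal.eq_top_iff_one _).mpr ((h 1).mpr ⟨x, ?_⟩))
    rw [eq_div_iff hs', ← map_mul] at hx
    have := IsFractionRing.injective N K hx
    linear_combination -this
  · push Not at hcase
    obtain ⟨t, ht, v, htv, hv⟩ := hcase
    refine Ideal.height_le_one_of_isPrincipal_of_mem_minimalPrimes (Ideal.span {t}) p
      ⟨⟨hp, (Ideal.span_singleton_le_iff_mem _).mpr ht⟩, fun Q hQ hQp b hb ↦ ?_⟩
    have hbt : v * b ∈ Q := by
      obtain ⟨b', hb'⟩ := (h b).mp hb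
      have : v * b = t * b' := mul_left_cancel₀ hs (by linear_combination -b * htv + t * hb')
      rw [this]
      exact Q.mul_mem_right _ (hQ.2 (Ideal.mem_span_singleton_self t))
    exact (hQ.1.mem_or_mem hbt).resolve_left fun h ↦ hv (hQp h)

/-- In a Noetherian normal domain, a fraction `y / s` which is not regular at the prime `q` fails to
be regular at a prime of height one contained in `q`. -/
theorem exists_height_le_one_not_dvd [IsIntegrallyClosed N] {q : Ideal N} [q.IsPrime] {s y : N}
    (hs : s ≠ 0) (h : ∀ t ∉ q, ¬ s ∣ t * y) :
    ∃ p : Ideal N, p.IsPrime ∧ p ≤ q ∧ p.height ≤ 1 ∧ ∀ t ∉ p, ¬ s ∣ t * y := by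
  let I : Ideal N := (Ideal.span {s}).colon {y}
  have hI : ∀ t, t ∈ I ↔ s ∣ t * y := fun t ↦ by
    simp [I, Submodule.mem_colon_singleton, Ideal.mem_span_singleton]
  have hIq : I ≤ q := fun t ht ↦ by
    by_contra htq
    exact h t htq ((hI t).mp ht)
  obtain ⟨p, hpI, hpq⟩ := Ideal.exists_minimalPrimes_le hIq
  have hpp : p.IsPrime := hpI.1.1
  obtain ⟨w, hw⟩ := Submodule.exists_eq_colon_of_mem_minimalPrimes hpI
  refine ⟨p, hpp, hpq, height_le_one_of_colon_isPrime (s := s) (w := w) hs fun t ↦ ?_,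
    fun t ht hd ↦ ht (hpI.1.2 ((hI t).mpr hd))⟩
  rw [hw, Submodule.mem_colon_singleton, smul_eq_mul, Ideal.mem_span_singleton]

end Normal

/-! ### Purity of the meeting locus of sections -/

section Idempotents

variable {N B : Type*} [CommRing N] [CommRing B] [Algebra N B] {T : Finset (B →ₐ[N] N)}

theorem isNilpotent_of_forall_section
    (hT : ∀ P : Ideal B, P.IsPrime → ∃ τ ∈ T, RingHom.ker τ ≤ P) {w : B} (hw : ∀ τ ∈ T, τ w = 0) :
    IsNilpotent w := by
  rw [← mem_nilradical, nilradical_eq_sInf, Ideal.mem_sInf]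
  intro P hP
  obtain ⟨τ, hτ, hle⟩ := hT P hP
  exact hle (hw τ hτ)

/-- If no other section in `T` is congruent to `τ₁` modulo the prime `p`, then, up to a denominator
`s ∉ p`, there is an idempotent which is `1` along `τ₁` and `0` along the other sections. -/
theorem exists_scaled_idempotent (hT : ∀ P : Ideal B, P.IsPrime → ∃ τ ∈ T, RingHom.ker τ ≤ P)
    {p : Ideal N} [p.IsPrime] (τ₁ : B →ₐ[N] N)
    (hsep : ∀ τ ∈ T, τ ≠ τ₁ → ∃ b, τ₁ b - τ b ∉ p) :
    ∃ s ∉ p, ∃ e : B, e * e = s • e ∧ τ₁ e = s ∧ ∀ τ ∈ T, τ ≠ τ₁ → τ e = 0 := by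
  classical
  choose! b hb using hsep
  -- `a` vanishes along every section other than `τ₁` and takes a value `c ∉ p` along `τ₁`, so
  -- `a * (a - c)` is nilpotent
  let a : B := ∏ τ ∈ T.erase τ₁, (b τ - algebraMap N B (τ (b τ)))
  set c : N := τ₁ a with hc
  have hcp : c ∉ p := by
    rw [hc, map_prod, Ideal.IsPrime.prod_mem_iff]
    rintro ⟨τ, hτ, h⟩
    rw [Finset.mem_erase] at hτ
    exact hb τ hτ.2 hτ.1 (by simpa using h)
  have ha : ∀ τ ∈ T, τ ≠ τ₁ → τ a = 0 := fun τ hτ hne ↦ by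
    rw [map_prod]
    exact Finset.prod_eq_zero (Finset.mem_erase.mpr ⟨hne, hτ⟩) (by simp)
  obtain ⟨m, hm⟩ : IsNilpotent (a * (a - algebraMap N B c)) := by
    refine isNilpotent_of_forall_section hT fun τ hτ ↦ ?_
    by_cases h : τ = τ₁
    · simp [h, hc]
    · simp [ha τ hτ h]
  have hm' : (a * (a - algebraMap N B c)) ^ (m + 1) = 0 := by rw [pow_succ, hm, zero_mul]
  have hmem : algebraMap N B c ^ ((m + 1) + (m + 1)) ∈
      Ideal.span {a} ^ (m + 1) ⊔ Ideal.span {a - algebraMap N B c} ^ (m + 1) := by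
    refine Ideal.sup_pow_add_le_pow_sup_pow (Ideal.pow_mem_pow ?_ _)
    have := Ideal.sub_mem (Ideal.span {a} ⊔ Ideal.span {a - algebraMap N B c}) (Ideal.mem_sup_left (Ideal.mem_span_singleton_self _))
      (Ideal.mem_sup_right (Ideal.mem_span_singleton_self _))
    rwa [sub_sub_cancel] at this
  rw [Ideal.span_singleton_pow, Ideal.span_singleton_pow, Ideal.mem_span_singleton_sup] at hmem
  obtain ⟨x, y, hy, hxy⟩ := hmem
  obtain ⟨y, rfl⟩ := Ideal.mem_span_singleton.mp hy
  refine ⟨c ^ ((m + 1) + (m + 1)), fun h ↦ hcp (‹p.IsPrime›.mem_of_pow_mem _ h),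
    x * a ^ (m + 1), ?_, ?_, fun τ hτ hne ↦ by simp [ha τ hτ hne]⟩
  · rw [Algebra.smul_def, map_pow, ← hxy]
    rw [mul_pow] at hm'
    linear_combination (-x * y) * hm'
  · have := congrArg τ₁ hxy
    simpa [← hc] using this

/-- An idempotent, up to a denominator, is determined by its values along the sections. -/
theorem smul_eq_smul_of_scaled_idempotent [IsDomain N] [Module.IsTorsionFree N B]
    (hT : ∀ P : Ideal B, P.IsPrime → ∃ τ ∈ T, RingHom.ker τ ≤ P) {τ₁ : B →ₐ[N] N} {s s' : N}
    (hs : s ≠ 0) (hs' : s' ≠ 0) {e e' : B} (he : e * e = s • e) (he' : e' * e' = s' • e')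
    (h₁ : τ₁ e = s) (h₁' : τ₁ e' = s') (h : ∀ τ ∈ T, τ ≠ τ₁ → τ e = 0)
    (h' : ∀ τ ∈ T, τ ≠ τ₁ → τ e' = 0) : s' • e = s • e' := by
  set w := s' • e - s • e' with hw
  suffices w = 0 from sub_eq_zero.mp this
  have hnil : IsNilpotent w := by
    refine isNilpotent_of_forall_section hT fun τ hτ ↦ ?_
    by_cases hτ₁ : τ = τ₁
    · simp [hw, hτ₁, h₁, h₁', mul_comm]
    · simp [hw, h τ hτ hτ₁, h' τ hτ hτ₁]
  -- a difference of two commuting idempotents equals its own cube, here up to denominators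
  have hcube : w * w * w = ((s * s') ^ 2) • w := by
    simp only [hw, Algebra.smul_def, map_mul, map_pow] at he he' ⊢
    generalize algebraMap N B s = s at *
    generalize algebraMap N B s' = s' at *
    linear_combination (s' ^ 3 * (e + s) - 3 * s' ^ 2 * s * e') * he +
      (3 * s' * s ^ 2 * e - s ^ 3 * (e' + s')) * he'
  have hpow : ∀ j : ℕ, w ^ (2 * j + 1) = ((s * s') ^ (2 * j)) • w := by
    intro j
    induction j with
    | zero => simp
    | succ j ih =>
      rw [show 2 * (j + 1) + 1 = (2 * j + 1) + 2 by ring, pow_add, ih, smul_mul_assoc,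
        show w * w ^ 2 = w * w * w by ring, hcube, smul_smul]
      congr 1
      ring
  obtain ⟨m, hm⟩ := hnil
  have h0 : ((s * s') ^ (2 * m)) • w = 0 := by
    rw [← hpow, show 2 * m + 1 = m + (m + 1) by ring, pow_add, hm, zero_mul]
  exact (smul_eq_zero.mp h0).resolve_left (pow_ne_zero _ (mul_ne_zero hs hs'))

/-- Purity: if sections of a finite projective algebra over a Noetherian normal domain exhaust its
spectrum and all meet over a point `q`, then two of them already meet in codimension one. Otherwise
the idempotent separating `τ₁` from the other sections would be regular at all primes of height one
below `q`, hence at `q`, where no idempotent separates sections that meet. -/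
theorem exists_height_le_one_forall_sub_mem [IsDomain N] [IsNoetherianRing N] [IsIntegrallyClosed N]
    [Module.Finite N B] [Module.Projective N B]
    (hT : ∀ P : Ideal B, P.IsPrime → ∃ τ ∈ T, RingHom.ker τ ≤ P)
    {q : Ideal N} [q.IsPrime] (hq : ∀ τ ∈ T, ∀ τ' ∈ T, ∀ b, τ b - τ' b ∈ q)
    {τ₁ τ₂ : B →ₐ[N] N} (h₁ : τ₁ ∈ T) (h₂ : τ₂ ∈ T) (h₁₂ : τ₂ ≠ τ₁) :
    ∃ p : Ideal N, p.IsPrime ∧ p ≤ q ∧ p.height ≤ 1 ∧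
      ∃ τ ∈ T, τ ≠ τ₁ ∧ ∀ b, τ₁ b - τ b ∈ p := by
  obtain ⟨s₀, hs₀, e₀, he₀, hτ₁, hτ⟩ := exists_scaled_idempotent hT (p := ⊥) τ₁ (by
    intro τ _ hne
    by_contra! h
    exact hne (AlgHom.ext fun b ↦ (sub_eq_zero.mp (h b)).symm))
  have hs₀ : s₀ ≠ 0 := hs₀
  -- present `B` as a direct summand of `Nⁿ` in order to speak of coordinates of `e₀ / s₀`
  obtain ⟨n, r, i, -, -, hri⟩ := Module.Finite.exists_comp_eq_id_of_projective N B
  obtain ⟨l, hl⟩ : ∃ l, ∀ t ∉ q, ¬ s₀ ∣ t * i e₀ l := by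
    by_contra! hcon
    choose t htq y hy using hcon
    let t' := ∏ l, t l
    have ht' : t' ∉ q := by
      rw [Ideal.IsPrime.prod_mem_iff]
      rintro ⟨l, -, hl⟩
      exact htq l hl
    have hdvd : ∀ l, s₀ ∣ t' * i e₀ l := fun l ↦
      (Dvd.intro _ (hy l).symm).trans (mul_dvd_mul_right (Finset.dvd_prod_of_mem t (Finset.mem_univ l)) _)
    choose z hz using hdvd
    have hte : t' • e₀ = s₀ • r z := by
      have h1 : t' • i e₀ = s₀ • z := funext hz
      have h2 : r (i e₀) = e₀ := LinearMap.congr_fun hri e₀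
      rw [← map_smul, ← h1, map_smul, h2]
    have e1 : t' = τ₁ (r z) := by
      have := congrArg τ₁ hte
      rw [map_smul, map_smul, hτ₁, smul_eq_mul, smul_eq_mul, mul_comm] at this
      exact mul_left_cancel₀ hs₀ this
    have e2 : 0 = τ₂ (r z) := by
      have := congrArg τ₂ hte
      rw [map_smul, map_smul, hτ τ₂ h₂ h₁₂, smul_eq_mul, smul_eq_mul, mul_zero] at this
      exact (mul_eq_zero.mp this.symm).resolve_left hs₀ |>.symm
    refine ht' ?_
    have := hq τ₁ h₁ τ₂ h₂ (r z)
    rwa [← e1, ← e2, sub_zero] at this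
  obtain ⟨p, hp, hpq, hht, hdvd⟩ := exists_height_le_one_not_dvd hs₀ hl
  refine ⟨p, hp, hpq, hht, ?_⟩
  by_contra! hcon
  obtain ⟨s, hs, e, he, hτ₁', hτ'⟩ := exists_scaled_idempotent hT (p := p) τ₁ hcon
  have hs0 : s ≠ 0 := fun h ↦ hs (h ▸ p.zero_mem)
  have heq := smul_eq_smul_of_scaled_idempotent hT hs₀ hs0 he₀ he hτ₁ hτ₁' hτ hτ'
  refine hdvd s hs ⟨i e l, ?_⟩
  have := congrFun (congrArg i heq) l
  simpa using this

end Idempotents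

/-! ### Finiteness of normalization -/

section Normalization

theorem finite_integralClosure_fractionRing (k : Type u) [Field k] [CharZero k] (D : Type u)
    [CommRing D] [IsDomain D] [Algebra k D] [Algebra.FiniteType k D] :
    Module.Finite D (integralClosure D (FractionRing D)) := by
  obtain ⟨s, g, hg, hfin⟩ := exists_finite_inj_algHom_of_fg k D
  algebraize [g.toRingHom]
  let B := MvPolynomial (Fin s) k
  have : IsScalarTower k B D := .of_algHom g
  have : Module.Finite B D := hfin
  have hinj : Function.Injective (algebraMap B D) := hg
  have := (faithfulSMul_iff_algebraMap_injective B D).mpr hinj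
  let K := FractionRing B
  let L := FractionRing D
  let C := integralClosure D L
  have : FaithfulSMul B L := .trans B D L
  let : Algebra K L := FractionRing.liftAlgebra B L
  have : IsScalarTower B K L := FractionRing.isScalarTower_liftAlgebra B L
  have : CharZero K := charZero_of_injective_algebraMap (algebraMap k K).injective
  have : FiniteDimensional K L := .of_isLocalization B D (nonZeroDivisors B)
  have : IsIntegralClosure C B L := ⟨Subtype.val_injective, fun {x} ↦
    ⟨fun hx ↦ ⟨⟨x, hx.tower_top⟩, rfl⟩, fun ⟨y, hy⟩ ↦ hy ▸ isIntegral_trans (R := B) _ y.2⟩⟩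
  have : Module.Finite B C := IsIntegralClosure.finite B K L C
  exact Module.Finite.of_restrictScalars_finite B D C

theorem exists_finite_isIntegrallyClosed (k : Type u) [Field k] [CharZero k] (D : Type u)
    [CommRing D] [IsDomain D] [Algebra k D] [Algebra.FiniteType k D] :
    ∃ (N : Type u) (_ : CommRing N) (_ : Algebra D N), IsDomain N ∧ IsIntegrallyClosed N ∧
      Module.Finite D N ∧ Function.Injective (algebraMap D N) := by
  refine ⟨integralClosure D (FractionRing D), inferInstance, inferInstance, inferInstance,
    integralClosure.isIntegrallyClosedOfFiniteExtension (FractionRing D),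
    finite_integralClosure_fractionRing k D, FaithfulSMul.algebraMap_injective _ _⟩

end Normalization

/-! ### Splitting families of sections -/

open scoped TensorProduct

section Split

variable {R A : Type*} [CommRing R] [CommRing A] [Algebra R A]

/-- The `D`-valued points in `T` exhaust the spectrum of the `D`-algebra `D ⊗[R] A`: every prime of
`D ⊗[R] A` contains the kernel, generated by the elements `σ a ⊗ 1 - 1 ⊗ a`, of the section
`D ⊗[R] A → D` defined by some `σ ∈ T`. Formulated on elements, the condition is visibly stable
under base change in `D`. -/
def IsSplitBy {D : Type*} [CommRing D] [Algebra R D] (T : Set (A →ₐ[R] D)) : Prop :=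
  ∀ P : Ideal (D ⊗[R] A), P.IsPrime → ∃ σ ∈ T, ∀ a, σ a ⊗ₜ[R] 1 - 1 ⊗ₜ[R] a ∈ P

/-- The section of the base change `D ⊗[R] A` defined by a `D`-valued point of `A`. -/
noncomputable def baseChangeSection {D : Type*} [CommRing D] [Algebra R D] (σ : A →ₐ[R] D) :
    D ⊗[R] A →ₐ[D] D :=
  Algebra.TensorProduct.lift (AlgHom.id D D) σ fun _ _ ↦ .all _ _

variable {D : Type*} [CommRing D] [Algebra R D]

@[simp]
theorem baseChangeSection_tmul (σ : A →ₐ[R] D) (d : D) (a : A) :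
    baseChangeSection σ (d ⊗ₜ a) = d * σ a := by
  simp [baseChangeSection]

theorem baseChangeSection_injective :
    Function.Injective (baseChangeSection : (A →ₐ[R] D) → (D ⊗[R] A →ₐ[D] D)) := fun σ τ h ↦ by
  ext a
  simpa using congrArg (· (1 ⊗ₜ a)) h

theorem sub_baseChangeSection_mem {P : Ideal (D ⊗[R] A)} {σ : A →ₐ[R] D}
    (h : ∀ a, σ a ⊗ₜ[R] 1 - 1 ⊗ₜ[R] a ∈ P) (x : D ⊗[R] A) :
    (baseChangeSection σ x) ⊗ₜ[R] 1 - x ∈ P := by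
  induction x with
  | zero => simp
  | tmul d a =>
    have := P.mul_mem_left (d ⊗ₜ[R] 1) (h a)
    simpa [mul_sub] using this
  | add x y hx hy =>
    have := P.add_mem hx hy
    rw [map_add, TensorProduct.add_tmul]
    convert this using 1
    ring

theorem ker_baseChangeSection_le {P : Ideal (D ⊗[R] A)} {σ : A →ₐ[R] D}
    (h : ∀ a, σ a ⊗ₜ[R] 1 - 1 ⊗ₜ[R] a ∈ P) : RingHom.ker (baseChangeSection σ) ≤ P := by
  intro x hx
  have := sub_baseChangeSection_mem h x
  rw [RingHom.mem_ker.mp hx, TensorProduct.zero_tmul, zero_sub] at this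
  simpa using this

theorem IsSplitBy.map {T : Set (A →ₐ[R] D)} (hT : IsSplitBy T) {E : Type*} [CommRing E] [Algebra R E]
    (φ : D →ₐ[R] E) : IsSplitBy ((fun σ ↦ φ.comp σ) '' T) := by
  intro P hP
  obtain ⟨σ, hσ, h⟩ := hT (P.comap (Algebra.TensorProduct.map φ (AlgHom.id R A)))
    (Ideal.comap_isPrime _ _)
  exact ⟨_, ⟨σ, hσ, rfl⟩, fun a ↦ by simpa using h a⟩

theorem IsSplitBy.exists_height_le_one [Module.Finite R A] [Module.Flat R A] [IsDomain D]
    [IsNoetherianRing D] [IsIntegrallyClosed D] {T : Finset (A →ₐ[R] D)}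
    (hT : IsSplitBy (T : Set (A →ₐ[R] D))) {q : Ideal D} [q.IsPrime]
    (hq : ∀ σ ∈ T, ∀ τ ∈ T, ∀ a, σ a - τ a ∈ q) (hcard : 1 < T.card) :
    ∃ p : Ideal D, p.IsPrime ∧ p ≤ q ∧ p.height ≤ 1 ∧
      ∃ σ ∈ T, ∃ τ ∈ T, σ ≠ τ ∧ ∀ a, σ a - τ a ∈ p := by
  classical
  obtain ⟨σ, hσ, τ, hτ, hne⟩ := Finset.one_lt_card.mp hcard
  have : Module.FinitePresentation D (D ⊗[R] A) := Module.finitePresentation_of_finite _ _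
  have : Module.Projective D (D ⊗[R] A) := Module.Flat.projective_of_finitePresentation
  obtain ⟨p, hp, hpq, hht, ρ', hρ', hne', h⟩ := exists_height_le_one_forall_sub_mem
    (T := T.image baseChangeSection) (B := D ⊗[R] A) (q := q) (τ₁ := baseChangeSection σ)
    (τ₂ := baseChangeSection τ) (fun P hP ↦ by
      obtain ⟨ρ, hρ, h⟩ := hT P hP
      exact ⟨_, Finset.mem_image_of_mem _ hρ, ker_baseChangeSection_le h⟩)
    (by
      intro α hα β hβ b
      obtain ⟨α, hα', rfl⟩ := Finset.mem_image.mp hα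
      obtain ⟨β, hβ', rfl⟩ := Finset.mem_image.mp hβ
      induction b with
      | zero => simp
      | tmul d a =>
        have := q.mul_mem_left d (hq α hα' β hβ' a)
        simpa [mul_sub] using this
      | add x y hx hy =>
        have := q.add_mem hx hy
        rw [map_add, map_add]
        convert this using 1
        ring)
    (Finset.mem_image_of_mem _ hσ) (Finset.mem_image_of_mem _ hτ)
    (baseChangeSection_injective.ne hne.symm)
  obtain ⟨ρ, hρ, rfl⟩ := Finset.mem_image.mp hρ'
  exact ⟨p, hp, hpq, hht, σ, hσ, ρ, hρ, fun e ↦ hne' (by rw [e]),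
    fun a ↦ by simpa using h (1 ⊗ₜ a)⟩

end Split

/-- If `n + 1` sections exhaust the spectrum of the algebra and all agree at `q`, then they all agree
along some closed subset of codimension at most `n` through `q`. By induction on the number of
sections: after normalising the base, purity makes two sections agree along a prime of height one,
and one restricts to it. -/
theorem IsSplitBy.exists_forall_sub_mem (k : Type u) [Field k] [CharZero k] {R A : Type u} [CommRing R]
    [CommRing A] [Algebra R A] [Module.Finite R A] [Module.Flat R A] (n : ℕ) (D : Type u) [CommRing D]
    [IsDomain D] [Algebra k D] [Algebra.FiniteType k D] [Algebra R D] (T : Finset (A →ₐ[R] D))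
    (hT : IsSplitBy (T : Set (A →ₐ[R] D))) (hcard : T.card ≤ n + 1) (q : Ideal D) [q.IsPrime]
    (hq : ∀ σ ∈ T, ∀ τ ∈ T, ∀ a, σ a - τ a ∈ q) :
    ∃ P : Ideal D, P.IsPrime ∧ P ≤ q ∧ (∀ σ ∈ T, ∀ τ ∈ T, ∀ a, σ a - τ a ∈ P) ∧
      ringKrullDim D ≤ ringKrullDim (D ⧸ P) + n := by
  classical
  induction n generalizing D with
  | zero =>
    refine ⟨⊥, Ideal.isPrime_bot, bot_le, fun σ hσ τ hτ a ↦ ?_, ?_⟩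
    · rw [Finset.card_le_one.mp hcard σ hσ τ hτ, sub_self]
      exact zero_mem _
    · simp [ringKrullDim_eq_of_ringEquiv (RingEquiv.quotientBot D)]
  | succ n ih =>
    by_cases hc : T.card ≤ 1
    · refine ⟨⊥, Ideal.isPrime_bot, bot_le, fun σ hσ τ hτ a ↦ ?_, ?_⟩
      · rw [Finset.card_le_one.mp hc σ hσ τ hτ, sub_self]
        exact zero_mem _
      · rw [ringKrullDim_eq_of_ringEquiv (RingEquiv.quotientBot D)]
        exact le_add_of_nonneg_right (by positivity)
    obtain ⟨N, _, _, _, _, _, hinj⟩ := exists_finite_isIntegrallyClosed k D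
    let : Algebra k N := ((algebraMap D N).comp (algebraMap k D)).toAlgebra
    have : IsScalarTower k D N := .of_algebraMap_eq fun _ ↦ rfl
    let : Algebra R N := ((algebraMap D N).comp (algebraMap R D)).toAlgebra
    have : IsScalarTower R D N := .of_algebraMap_eq fun _ ↦ rfl
    have : Algebra.FiniteType k N := .trans ‹_› (inferInstance : Algebra.FiniteType D N)
    have : IsNoetherianRing D := Algebra.FiniteType.isNoetherianRing k D
    have : IsNoetherianRing N := Algebra.FiniteType.isNoetherianRing k N
    obtain ⟨qN, -, hqN, hqNq⟩ := Ideal.exists_ideal_over_prime_of_isIntegral q (⊥ : Ideal N)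
      (by rw [← RingHom.ker_eq_comap_bot, (RingHom.injective_iff_ker_eq_bot _).mp hinj]; exact bot_le)
    let φ : D →ₐ[R] N := IsScalarTower.toAlgHom R D N
    have hφ : Function.Injective φ := hinj
    have hTN : IsSplitBy ((T.image fun σ ↦ φ.comp σ : Finset (A →ₐ[R] N)) : Set (A →ₐ[R] N)) := by
      rw [Finset.coe_image]
      exact hT.map φ
    have hcardN : (T.image fun σ ↦ φ.comp σ).card = T.card :=
      Finset.card_image_of_injective _ fun σ τ h ↦ AlgHom.ext fun a ↦ hφ (AlgHom.congr_fun h a)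
    have hqT : ∀ σ ∈ T.image fun σ ↦ φ.comp σ, ∀ τ ∈ T.image fun σ ↦ φ.comp σ,
        ∀ a, σ a - τ a ∈ qN := by
      simp only [Finset.forall_mem_image]
      intro σ hσ τ hτ a
      have := hq σ hσ τ hτ a
      rw [← hqNq, Ideal.mem_comap, map_sub] at this
      exact this
    obtain ⟨p, hp, hpq, hht, σ, hσ, τ, hτ, hne, hστ⟩ :=
      hTN.exists_height_le_one hqT (by omega)
    let ψ : N →ₐ[R] N ⧸ p := Ideal.Quotient.mkₐ R p
    let T' := (T.image fun σ ↦ φ.comp σ).image fun σ ↦ ψ.comp σ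
    have hcard' : T'.card ≤ n + 1 := by
      have : T'.card < (T.image fun σ ↦ φ.comp σ).card := by
        refine Finset.card_image_le.lt_of_ne fun h ↦ hne ?_
        exact Finset.card_image_iff.mp h hσ hτ (AlgHom.ext fun a ↦ Ideal.Quotient.eq.mpr (hστ a))
      omega
    have hT' : IsSplitBy (T' : Set (A →ₐ[R] N ⧸ p)) := by
      rw [Finset.coe_image]
      exact hTN.map ψ
    have hq' : (qN.map (Ideal.Quotient.mk p)).IsPrime :=
      Ideal.map_isPrime_of_surjective Ideal.Quotient.mk_surjective (by simpa using hpq)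
    obtain ⟨P', hP', hP'q, hP'T, hdim⟩ := ih (N ⧸ p) T' hT' hcard' (qN.map (Ideal.Quotient.mk p)) (by
      simp only [T', Finset.forall_mem_image]
      intro σ hσ τ hτ a
      exact Ideal.mem_map_of_mem (Ideal.Quotient.mk p)
        (hqT _ (Finset.mem_image_of_mem _ hσ) _ (Finset.mem_image_of_mem _ hτ) a))
    refine ⟨P'.under D, inferInstance, ?_, ?_, ?_⟩
    · have h1 : P'.comap (Ideal.Quotient.mk p) ≤ qN := by
        refine (Ideal.comap_mono hP'q).trans ?_
        rw [Ideal.comap_map_of_surjective _ Ideal.Quotient.mk_surjective, ← RingHom.ker_eq_comap_bot,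
          Ideal.mk_ker, sup_eq_left.mpr hpq]
      rw [← hqNq]
      exact fun x hx ↦ h1 hx
    · intro σ hσ τ hτ a
      have := hP'T _ (Finset.mem_image_of_mem _ (Finset.mem_image_of_mem _ hσ)) _
        (Finset.mem_image_of_mem _ (Finset.mem_image_of_mem _ hτ)) a
      rw [Ideal.mem_comap, map_sub]
      exact this
    · have h1 : ringKrullDim ((N ⧸ p) ⧸ P') ≤ ringKrullDim (D ⧸ P'.under D) :=
        ringKrullDim_le_of_isIntegral (D ⧸ P'.under D) ((N ⧸ p) ⧸ P')
      calc ringKrullDim D = ringKrullDim N := (ringKrullDim_eq_of_isIntegral D N hinj).symm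
        _ ≤ ringKrullDim (N ⧸ p) + 1 :=
          ringKrullDim_le_ringKrullDim_quotient_add_one_of_height_le_one k N p hht
        _ ≤ ringKrullDim ((N ⧸ p) ⧸ P') + n + 1 := by gcongr
        _ ≤ ringKrullDim (D ⧸ P'.under D) + n + 1 := by gcongr
        _ = _ := by push_cast; rw [add_assoc]

theorem Subalgebra.fg_iSup_range {R A Ω : Type*} [CommRing R] [CommRing A] [Algebra R A]
    [Algebra.FiniteType R A] [CommRing Ω] [Algebra R Ω] [Finite (A →ₐ[R] Ω)] :
    (⨆ σ : A →ₐ[R] Ω, σ.range).FG := by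
  cases nonempty_fintype (A →ₐ[R] Ω)
  rw [← Finset.sup_univ_eq_iSup]
  refine Finset.sup_induction Subalgebra.fg_bot (fun _ h₁ _ h₂ ↦ h₁.sup h₂) fun σ _ ↦ ?_
  rw [← Algebra.map_top]
  exact (Algebra.FiniteType.out (R := R) (A := A)).map σ

theorem Algebra.isIntegral_iSup_range {R A Ω : Type*} [CommRing R] [CommRing A] [Algebra R A]
    [Algebra.IsIntegral R A] [CommRing Ω] [Algebra R Ω] :
    Algebra.IsIntegral R ↥(⨆ σ : A →ₐ[R] Ω, σ.range) := by
  have hle : (⨆ σ : A →ₐ[R] Ω, σ.range) ≤ integralClosure R Ω := by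
    refine iSup_le fun σ ↦ ?_
    rintro _ ⟨a, rfl⟩
    exact (Algebra.IsIntegral.isIntegral (R := R) a).map σ
  exact ⟨fun x ↦ (isIntegral_algHom_iff (Subalgebra.val _) Subtype.val_injective).mp (hle x.2)⟩

theorem natCard_algHom_le_finrank_and_finite (R A Ω : Type*) [CommRing R] [CommRing A] [Algebra R A]
    [Module.Finite R A] [Field Ω] [Algebra R Ω] :
    Nat.card (A →ₐ[R] Ω) ≤ Module.finrank Ω (Ω ⊗[R] A) ∧ Finite (A →ₐ[R] Ω) := by
  have : Finite (Ω ⊗[R] A →ₐ[Ω] Ω) := inferInstance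
  exact ⟨(Nat.card_le_card_of_injective _ baseChangeSection_injective).trans
    (card_algHom_le_finrank Ω _ Ω), .of_injective _ baseChangeSection_injective⟩

/-- If every geometric generic point of a finite flat algebra comes from a section in `T`, then `T`
splits the algebra: flatness makes every prime specialise from one over the generic point. -/
theorem isSplitBy_of_isAlgClosed {R A D Ω : Type*} [CommRing R] [CommRing A] [Algebra R A]
    [Module.Finite R A] [Module.Flat R A] [CommRing D] [IsDomain D] [Algebra R D] [Field Ω]
    [IsAlgClosed Ω] [Algebra R Ω] [Algebra D Ω] [IsScalarTower R D Ω] [FaithfulSMul D Ω]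
    {T : Set (A →ₐ[R] D)}
    (hT : ∀ σ : A →ₐ[R] Ω, ∃ τ ∈ T, ∀ a, algebraMap D Ω (τ a) = σ a) : IsSplitBy T := by
  intro P hP
  -- by flatness `P` contains a prime lying over the generic point of `Spec D`
  obtain ⟨P₀, hP₀P, hP₀, hlies⟩ := Ideal.exists_ideal_le_liesOver_of_le (p := (⊥ : Ideal D))
    (q := P.under D) P bot_le
  let E := (D ⊗[R] A) ⧸ P₀
  have hinj : Function.Injective (algebraMap D E) := by
    rw [RingHom.injective_iff_ker_eq_bot, hlies.over, Ideal.under_def]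
    ext x
    rw [RingHom.mem_ker, Ideal.mem_comap, ← Ideal.Quotient.eq_zero_iff_mem]
    rfl
  have hfaith : FaithfulSMul D E := (faithfulSMul_iff_algebraMap_injective D E).mpr hinj
  have : Module.Finite D E := inferInstance
  have : IsDomain E := inferInstance
  have : Module.IsTorsionFree D E := Module.isTorsionFree_iff_faithfulSMul.mpr hfaith
  let ℓ : E →ₐ[D] Ω := IsAlgClosed.lift
  have hℓ : Function.Injective ℓ := by
    rw [← AlgHom.coe_toRingHom, RingHom.injective_iff_ker_eq_bot]
    refine Ideal.eq_bot_of_comap_eq_bot (R := D) ?_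
    rw [eq_bot_iff]
    intro x hx
    have : ℓ (algebraMap D E x) = 0 := hx
    rw [AlgHom.commutes] at this
    exact FaithfulSMul.algebraMap_injective D Ω (by rw [this, map_zero])
  let σ : A →ₐ[R] Ω := ((ℓ.comp (Ideal.Quotient.mkₐ D P₀)).restrictScalars R).comp
    Algebra.TensorProduct.includeRight
  obtain ⟨τ, hτ, h⟩ := hT σ
  refine ⟨τ, hτ, fun a ↦ hP₀P ?_⟩
  rw [← Ideal.Quotient.eq_zero_iff_mem]
  refine hℓ ?_
  rw [map_zero, map_sub, map_sub, sub_eq_zero]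
  exact (ℓ.commutes (τ a)).trans (h a)

/-- Over the closed set `V(p)`, a finite flat algebra of rank `d` is split by at most `d` sections
after a finite base change, namely after adjoining the values of all its points over an algebraic
closure of the residue field at `p`. -/
theorem exists_isSplitBy {R A : Type u} [CommRing R] [CommRing A] [Algebra R A] [Module.Finite R A]
    [Module.Flat R A] (d : ℕ) (hd : ∀ x : PrimeSpectrum R, Module.rankAtStalk A x = d) (p : Ideal R)
    [p.IsPrime] :
    ∃ (D : Type u) (_ : CommRing D) (_ : Algebra R D) (T : Finset (A →ₐ[R] D)), IsDomain D ∧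
      Algebra.IsIntegral R D ∧ Algebra.FiniteType R D ∧ RingHom.ker (algebraMap R D) = p ∧
      T.card ≤ d ∧ IsSplitBy (T : Set (A →ₐ[R] D)) := by
  classical
  let Ω := AlgebraicClosure (FractionRing (R ⧸ p))
  have : FaithfulSMul (R ⧸ p) Ω := .trans _ (FractionRing (R ⧸ p)) _
  have hker : RingHom.ker (algebraMap R Ω) = p := by
    ext x
    rw [RingHom.mem_ker, ← Ideal.Quotient.eq_zero_iff_mem, IsScalarTower.algebraMap_apply R (R ⧸ p) Ω]
    exact map_eq_zero_iff (algebraMap (R ⧸ p) Ω) (FaithfulSMul.algebraMap_injective _ _)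
  obtain ⟨hcard, hfin⟩ := natCard_algHom_le_finrank_and_finite R A Ω
  have hrank : Module.finrank Ω (Ω ⊗[R] A) = d := by
    have := Module.rankAtStalk_baseChange (R := R) (M := A) (S := Ω) ⊥
    rw [hd, Module.rankAtStalk_eq_finrank_of_free] at this
    exact this
  rw [hrank] at hcard
  let D : Subalgebra R Ω := ⨆ σ : A →ₐ[R] Ω, σ.range
  have hD : ∀ (σ : A →ₐ[R] Ω) (a : A), σ a ∈ D := fun σ a ↦
    le_iSup (fun σ : A →ₐ[R] Ω ↦ σ.range) σ ⟨a, rfl⟩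
  cases nonempty_fintype (A →ₐ[R] Ω)
  refine ⟨D, inferInstance, inferInstance, Finset.univ.image fun σ : A →ₐ[R] Ω ↦ σ.codRestrict D (hD σ),
    inferInstance, Algebra.isIntegral_iSup_range, ?_, ?_, ?_, ?_⟩
  · exact (Subalgebra.fg_iff_finiteType D).mp Subalgebra.fg_iSup_range
  · refine Eq.trans ?_ hker
    ext x
    simp only [RingHom.mem_ker]
    exact (map_eq_zero_iff (Subalgebra.val D) Subtype.val_injective).symm
  · exact Finset.card_image_le.trans (by simpa using hcard)
  · exact isSplitBy_of_isAlgClosed (Ω := Ω) fun σ ↦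
      ⟨σ.codRestrict D (hD σ), by simp, fun _ ↦ rfl⟩

/-- The fibre over a geometric point is a single point if and only if all sections of a splitting
family agree there. -/
theorem IsSplitBy.exists_forall_eq_iff {R A D Ω : Type*} [CommRing R] [CommRing A] [Algebra R A]
    [CommRing D] [Algebra R D] [Field Ω] [Algebra R Ω] {T : Set (A →ₐ[R] D)} (hT : IsSplitBy T)
    (φ : D →ₐ[R] Ω) :
    (∃ x : PrimeSpectrum (Ω ⊗[R] A), ∀ y, y = x) ↔
      T.Nonempty ∧ ∀ σ ∈ T, ∀ τ ∈ T, ∀ a, σ a - τ a ∈ RingHom.ker φ := by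
  let pt (σ : A →ₐ[R] D) : PrimeSpectrum (Ω ⊗[R] A) :=
    ⟨RingHom.ker (baseChangeSection (φ.comp σ)), RingHom.ker_isPrime _⟩
  have hpt : ∀ y, ∃ σ ∈ T, y = pt σ := by
    intro y
    obtain ⟨_, ⟨σ, hσ, rfl⟩, h⟩ := hT.map φ y.asIdeal y.2
    refine ⟨σ, hσ, PrimeSpectrum.ext ?_⟩
    have hmax : (RingHom.ker (baseChangeSection (φ.comp σ))).IsMaximal :=
      RingHom.ker_isMaximal_of_surjective _ fun x ↦ ⟨x ⊗ₜ 1, by simp⟩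
    exact (hmax.eq_of_le y.2.ne_top (ker_baseChangeSection_le h)).symm
  constructor
  · rintro ⟨x, hx⟩
    obtain ⟨σ, hσ, -⟩ := hpt x
    refine ⟨⟨σ, hσ⟩, fun σ hσ τ hτ a ↦ ?_⟩
    have h : pt σ = pt τ := (hx _).trans (hx _).symm
    have hmem : φ (σ a) ⊗ₜ[R] 1 - 1 ⊗ₜ[R] a ∈ (pt σ).asIdeal := by
      change _ ∈ RingHom.ker _
      simp [RingHom.mem_ker]
    rw [h] at hmem
    change _ ∈ RingHom.ker _ at hmem
    simpa [RingHom.mem_ker] using hmem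
  · rintro ⟨⟨σ, hσ⟩, h⟩
    refine ⟨pt σ, fun y ↦ ?_⟩
    obtain ⟨τ, hτ, rfl⟩ := hpt y
    have : φ.comp τ = φ.comp σ := AlgHom.ext fun a ↦ sub_eq_zero.mp (by
      simpa [RingHom.mem_ker] using h τ hτ σ hσ a)
    simp only [pt, this]

/-! ### The branch locus of a finite flat algebra -/

theorem IsSplitBy.exists_forall_eq_iff_of_isIntegral {R A D Ω : Type*} [CommRing R] [CommRing A]
    [Algebra R A] [CommRing D] [Algebra R D] [Algebra.IsIntegral R D] [Field Ω] [IsAlgClosed Ω]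
    [Algebra R Ω] {T : Set (A →ₐ[R] D)} (hT : IsSplitBy T) (q : Ideal D) [q.IsPrime]
    (hq : RingHom.ker (algebraMap R Ω) = q.under R) :
    (∃ x : PrimeSpectrum (Ω ⊗[R] A), ∀ y, y = x) ↔
      T.Nonempty ∧ ∀ σ ∈ T, ∀ τ ∈ T, ∀ a, σ a - τ a ∈ q := by
  let φ₀ : R ⧸ q.under R →ₐ[R] Ω := Ideal.Quotient.liftₐ (q.under R) (Algebra.ofId R Ω)
    fun a ha ↦ by rwa [← hq] at ha
  have hφ₀ : Function.Injective φ₀ := by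
    rw [injective_iff_map_eq_zero]
    intro a
    obtain ⟨a, rfl⟩ := Ideal.Quotient.mk_surjective a
    intro ha
    rw [Ideal.Quotient.eq_zero_iff_mem, ← hq]
    exact ha
  let : Algebra (R ⧸ q.under R) Ω := φ₀.toRingHom.toAlgebra
  have : IsScalarTower R (R ⧸ q.under R) Ω := .of_algebraMap_eq fun x ↦ (φ₀.commutes x).symm
  have : FaithfulSMul (R ⧸ q.under R) Ω := (faithfulSMul_iff_algebraMap_injective _ _).mpr hφ₀
  have : Module.IsTorsionFree (R ⧸ q.under R) (D ⧸ q) :=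
    Module.isTorsionFree_iff_faithfulSMul.mpr inferInstance
  have : Algebra.IsIntegral (R ⧸ q.under R) (D ⧸ q) := inferInstance
  let ℓ : D ⧸ q →ₐ[R ⧸ q.under R] Ω := IsAlgClosed.lift
  have hℓ : Function.Injective ℓ := by
    rw [← AlgHom.coe_toRingHom, RingHom.injective_iff_ker_eq_bot]
    refine Ideal.eq_bot_of_comap_eq_bot (R := R ⧸ q.under R) ?_
    rw [eq_bot_iff]
    intro x hx
    have : ℓ (algebraMap _ (D ⧸ q) x) = 0 := hx
    rw [AlgHom.commutes] at this
    exact FaithfulSMul.algebraMap_injective _ Ω (by rw [this, map_zero])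
  let φ : D →ₐ[R] Ω := (ℓ.restrictScalars R).comp (Ideal.Quotient.mkₐ R q)
  have hφ : RingHom.ker φ = q := by
    ext x
    rw [RingHom.mem_ker, ← Ideal.Quotient.eq_zero_iff_mem]
    exact map_eq_zero_iff ℓ hℓ
  rw [hT.exists_forall_eq_iff φ, hφ]

/-- `Z` is the set of points of `Spec R` whose geometric fibre in `Spec A` is a single point. The
fibre over `q` is tested at some geometric point over `q`, whose field is left unspecified, since a
residue field of a scheme is only isomorphic to the one of an affine chart. -/
def IsTotalBranchLocus (R A : Type u) [CommRing R] [CommRing A] [Algebra R A]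
    (Z : Set (PrimeSpectrum R)) : Prop :=
  ∀ q : PrimeSpectrum R, ∃ (Ω : Type u) (_ : Field Ω) (_ : Algebra R Ω), IsAlgClosed Ω ∧
    RingHom.ker (algebraMap R Ω) = q.asIdeal ∧
      (q ∈ Z ↔ ∃ x : PrimeSpectrum (Ω ⊗[R] A), ∀ y, y = x)

namespace IsTotalBranchLocus

variable {R A : Type u} [CommRing R] [CommRing A] [Algebra R A] {Z : Set (PrimeSpectrum R)}

theorem mem_iff (hZ : IsTotalBranchLocus R A Z) {D : Type*} [CommRing D] [Algebra R D]
    [Algebra.IsIntegral R D] {T : Set (A →ₐ[R] D)} (hT : IsSplitBy T) (q : PrimeSpectrum D) :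
    q.comap (algebraMap R D) ∈ Z ↔
      T.Nonempty ∧ ∀ σ ∈ T, ∀ τ ∈ T, ∀ a, σ a - τ a ∈ q.asIdeal := by
  obtain ⟨Ω, _, _, _, hker, hiff⟩ := hZ (q.comap (algebraMap R D))
  rw [hiff, hT.exists_forall_eq_iff_of_isIntegral q.asIdeal hker]

variable [Module.Finite R A] [Module.Flat R A] {d : ℕ}

/-- On `V(p)`, the branch locus is the image, under a finite morphism, of the closed set where all
sections agree. -/
theorem isClosed_inter_zeroLocus (hZ : IsTotalBranchLocus R A Z)
    (hd : ∀ x : PrimeSpectrum R, Module.rankAtStalk A x = d) (p : Ideal R) [p.IsPrime] :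
    IsClosed (Z ∩ PrimeSpectrum.zeroLocus p) := by
  obtain ⟨D, _, _, T, _, _, _, hker, -, hT⟩ := exists_isSplitBy (A := A) d hd p
  let C : Set (PrimeSpectrum D) :=
    {q | (T : Set (A →ₐ[R] D)).Nonempty ∧ ∀ σ ∈ T, ∀ τ ∈ T, ∀ a, σ a - τ a ∈ q.asIdeal}
  have hC : IsClosed C := by
    have hCeq : C = {q | (T : Set (A →ₐ[R] D)).Nonempty} ∩ ⋂ σ ∈ T, ⋂ τ ∈ T, ⋂ a,
        PrimeSpectrum.zeroLocus {σ a - τ a} := by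
      ext q
      simp [C]
    rw [hCeq]
    refine isClosed_const.inter ?_
    exact isClosed_biInter fun _ _ ↦ isClosed_biInter fun _ _ ↦ isClosed_iInter fun _ ↦
      PrimeSpectrum.isClosed_zeroLocus _
  have hcl := PrimeSpectrum.isClosedMap_comap_of_isIntegral (algebraMap R D)
    (algebraMap_isIntegral_iff.mpr ‹_›) C hC
  convert hcl using 1
  ext q
  constructor
  · rintro ⟨hqZ, hqp⟩
    obtain ⟨Q, hQ, hQq⟩ := Ideal.exists_ideal_over_prime_of_isIntegral_of_isDomain (S := D) q.asIdeal
      (by rw [hker]; exact hqp)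
    have hq : PrimeSpectrum.comap (algebraMap R D) ⟨Q, hQ⟩ = q := PrimeSpectrum.ext hQq
    rw [← hq] at hqZ ⊢
    exact ⟨_, (hZ.mem_iff hT _).mp hqZ, rfl⟩
  · rintro ⟨Q, hQ, rfl⟩
    refine ⟨(hZ.mem_iff hT Q).mpr hQ, ?_⟩
    rw [PrimeSpectrum.mem_zeroLocus, ← hker]
    exact Ideal.comap_mono bot_le

theorem isClosed [IsNoetherianRing R] (hZ : IsTotalBranchLocus R A Z)
    (hd : ∀ x : PrimeSpectrum R, Module.rankAtStalk A x = d) : IsClosed Z := by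
  have hZeq : Z = ⋃ p ∈ minimalPrimes R, Z ∩ PrimeSpectrum.zeroLocus p := by
    ext q
    simp only [Set.mem_iUnion, Set.mem_inter_iff, PrimeSpectrum.mem_zeroLocus, SetLike.coe_subset_coe,
      exists_prop]
    refine ⟨fun h ↦ ?_, fun ⟨_, _, h, _⟩ ↦ h⟩
    obtain ⟨p, hp, hpq⟩ := Ideal.exists_minimalPrimes_le (bot_le : ⊥ ≤ q.asIdeal)
    exact ⟨p, hp, h, hpq⟩
  rw [hZeq]
  refine (minimalPrimes.finite_of_isNoetherianRing R).isClosed_biUnion fun p hp ↦ ?_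
  have : p.IsPrime := hp.1.1
  exact hZ.isClosed_inter_zeroLocus hd p

/-- If `q` lies in the branch locus, every irreducible closed subset `V(p)` through `q`
contains an irreducible closed subset of the branch locus through `q` of codimension less than
`d`. -/
theorem exists_mem_ringKrullDim_le (k : Type u) [Field k] [CharZero k] [Algebra k R]
    [Algebra.FiniteType k R] (hZ : IsTotalBranchLocus R A Z)
    (hd : ∀ x : PrimeSpectrum R, Module.rankAtStalk A x = d) (p : Ideal R) [p.IsPrime]
    {q : PrimeSpectrum R} (hpq : p ≤ q.asIdeal) (hq : q ∈ Z) :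
    ∃ P : PrimeSpectrum R, P ∈ Z ∧ P ≤ q ∧
      ringKrullDim (R ⧸ p) + 1 ≤ ringKrullDim (R ⧸ P.asIdeal) + d := by
  obtain ⟨D, _, _, T, _, _, _, hker, hcard, hT⟩ := exists_isSplitBy (A := A) d hd p
  obtain ⟨Q, hQ, hQq⟩ := Ideal.exists_ideal_over_prime_of_isIntegral_of_isDomain (S := D) q.asIdeal
      (by rw [hker]; exact hpq)
  have hq' : PrimeSpectrum.comap (algebraMap R D) ⟨Q, hQ⟩ = q := PrimeSpectrum.ext hQq
  rw [← hq', hZ.mem_iff hT] at hq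
  let : Algebra k D := ((algebraMap R D).comp (algebraMap k R)).toAlgebra
  have : IsScalarTower k R D := .of_algebraMap_eq fun _ ↦ rfl
  have : Algebra.FiniteType k D := .trans ‹Algebra.FiniteType k R› ‹_›
  have hpos : 0 < T.card := Finset.card_pos.mpr hq.1
  obtain ⟨P, hP, hPQ, hPT, hdim⟩ := IsSplitBy.exists_forall_sub_mem k (T.card - 1) D T hT (by omega) Q
    hq.2
  refine ⟨PrimeSpectrum.comap (algebraMap R D) ⟨P, hP⟩, (hZ.mem_iff hT _).mpr ⟨hq.1, hPT⟩, ?_, ?_⟩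
  · rw [← hq']
    exact Ideal.comap_mono hPQ
  have hlies : (⊥ : Ideal D).LiesOver p := ⟨hker.symm⟩
  have h1 : ringKrullDim D = ringKrullDim (R ⧸ p) := by
    rw [← ringKrullDim_eq_of_ringEquiv (RingEquiv.quotientBot D)]
    exact ringKrullDim_eq_of_isIntegral (R ⧸ p) (D ⧸ (⊥ : Ideal D))
      (FaithfulSMul.algebraMap_injective _ _)
  have h2 : ringKrullDim (D ⧸ P) ≤ ringKrullDim (R ⧸ P.under R) :=
    ringKrullDim_le_of_isIntegral (R ⧸ P.under R) (D ⧸ P)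
  calc ringKrullDim (R ⧸ p) + 1 ≤ ringKrullDim (D ⧸ P) + (T.card - 1 : ℕ) + 1 := by
        rw [← h1]; gcongr
    _ = ringKrullDim (D ⧸ P) + T.card := by
        rw [add_assoc]; congr 1; exact_mod_cast Nat.sub_add_cancel hpos
    _ ≤ ringKrullDim (R ⧸ P.under R) + d := by gcongr

end IsTotalBranchLocus

/-! ### Local dimension in an affine chart -/

section LocalDim

variable {S : Type*} [TopologicalSpace S] {R : Type u} [CommRing R] {j : PrimeSpectrum R → S}

theorem ringKrullDim_away_le_of_forall_minimalPrimes (g : R) {M : WithBot ℕ∞}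
    (hM : ∀ p ∈ minimalPrimes R, g ∉ p → ringKrullDim (R ⧸ p) ≤ M) :
    ringKrullDim (Localization.Away g) ≤ M := by
  refine iSup_le fun l ↦ ?_
  let c : PrimeSpectrum (Localization.Away g) → PrimeSpectrum R :=
    PrimeSpectrum.comap (algebraMap R (Localization.Away g))
  have hc : StrictMono c :=
    (IsLocalization.orderEmbedding (Submonoid.powers g) (Localization.Away g)).strictMono.comp
      fun _ _ h ↦ h
  obtain ⟨p, hp, hpl⟩ := Ideal.exists_minimalPrimes_le (bot_le : ⊥ ≤ (c l.head).asIdeal)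
  have hgp : g ∉ p := fun h ↦ l.head.2.ne_top
    (Ideal.eq_top_of_isUnit_mem _ (hpl h) (IsLocalization.Away.algebraMap_isUnit g))
  refine le_trans ?_ (hM p hp hgp)
  rw [ringKrullDim_quotient]
  let L : LTSeries (PrimeSpectrum.zeroLocus (p : Set R)) :=
    { length := l.length
      toFun := fun i ↦ ⟨c (l i), hpl.trans (hc.monotone (LTSeries.head_le l i))⟩
      step := fun i ↦ hc (l.step i) }
  exact Order.LTSeries.length_le_krullDim L

/-- The local dimension at `z` is attained along a single irreducible component through `z`. -/
theorem exists_localDim_le_ringKrullDim_quotient [IsNoetherianRing R]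
    (hj : Topology.IsOpenEmbedding j) (q : PrimeSpectrum R) :
    ∃ p : Ideal R, p.IsPrime ∧ p ≤ q.asIdeal ∧ localDim S (j q) ≤ ringKrullDim (R ⧸ p) := by
  have hfin := minimalPrimes.finite_of_isNoetherianRing R
  obtain ⟨p₁, hp₁, hp₁q⟩ := Ideal.exists_minimalPrimes_le (bot_le : ⊥ ≤ q.asIdeal)
  obtain ⟨p, ⟨hp, hpq⟩, hmax⟩ := Set.exists_max_image {p ∈ minimalPrimes R | p ≤ q.asIdeal}
    (fun p ↦ ringKrullDim (R ⧸ p)) (hfin.subset (Set.sep_subset _ _)) ⟨p₁, hp₁, hp₁q⟩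
  -- `g` cuts away the components of `Spec R` that do not pass through `q`
  obtain ⟨g, hgq, hg⟩ : ∃ g ∉ q.asIdeal, ∀ p ∈ minimalPrimes R, ¬ p ≤ q.asIdeal → g ∈ p := by
    have h : ∀ p : Ideal R, ∃ x ∈ p, ¬ p ≤ q.asIdeal → x ∉ q.asIdeal := fun p ↦ by
      by_cases hp : p ≤ q.asIdeal
      · exact ⟨0, p.zero_mem, fun h ↦ (h hp).elim⟩
      · obtain ⟨x, hx, hxq⟩ := Set.not_subset.mp hp
        exact ⟨x, hx, fun _ ↦ hxq⟩
    choose x hxp hxq using h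
    refine ⟨∏ p ∈ (hfin.subset (Set.sep_subset (minimalPrimes R) fun p ↦ ¬ p ≤ q.asIdeal)).toFinset,
      x p, ?_, fun p hp hpq ↦ ?_⟩
    · rw [Ideal.IsPrime.prod_mem_iff]
      rintro ⟨p, hp, h⟩
      exact hxq p (by simpa using (Set.Finite.mem_toFinset _).mp hp |>.2) h
    · exact Ideal.mem_of_dvd _ (Finset.dvd_prod_of_mem x (by simpa using ⟨hp, hpq⟩)) (hxp p)
  refine ⟨p, hp.1.1, hpq, ?_⟩
  let c : PrimeSpectrum (Localization.Away g) → PrimeSpectrum R :=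
    PrimeSpectrum.comap (algebraMap R (Localization.Away g))
  have hc : Topology.IsOpenEmbedding c := PrimeSpectrum.localization_away_isOpenEmbedding _ g
  have hjc := hj.comp hc
  let U : TopologicalSpace.Opens S := ⟨Set.range (j ∘ c), hjc.isOpen_range⟩
  have hqU : j q ∈ U := by
    have : q ∈ Set.range c := by
      rw [PrimeSpectrum.localization_away_comap_range (Localization.Away g) g]
      exact hgq
    obtain ⟨y, rfl⟩ := this
    exact ⟨y, rfl⟩
  refine (iInf₂_le U hqU).trans ?_
  have hU : topologicalKrullDim U = ringKrullDim (Localization.Away g) := by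
    rw [← PrimeSpectrum.topologicalKrullDim_eq_ringKrullDim]
    exact (IsHomeomorph.topologicalKrullDim_eq _ hjc.toIsEmbedding.toHomeomorph.isHomeomorph).symm
  rw [hU]
  refine ringKrullDim_away_le_of_forall_minimalPrimes g fun p' hp' hgp' ↦ hmax p' ⟨hp', ?_⟩
  by_contra h
  exact hgp' (hg p' hp' h)

/-- Every neighbourhood of `j q` in `Z` contains a dense open subset of the image of `V(P)`, and
shrinking does not lower the dimension of `V(P)`, as `R` is of finite type over a field. -/
theorem ringKrullDim_quotient_le_localDim (k : Type u) [Field k] [Algebra k R] [Algebra.FiniteType k R]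
    (hj : Topology.IsOpenEmbedding j) {Z : Set S} {P q : PrimeSpectrum R} (hPq : P ≤ q)
    (hP : ∀ x, P ≤ x → j x ∈ Z) :
    ringKrullDim (R ⧸ P.asIdeal) ≤ localDim Z ⟨j q, hP q hPq⟩ := by
  refine le_iInf₂ fun W hqW ↦ ?_
  obtain ⟨O, hO, hOW⟩ := isOpen_induced_iff.mp W.2
  have hqO : q ∈ j ⁻¹' O := by
    have : (⟨j q, hP q hPq⟩ : Z) ∈ Subtype.val ⁻¹' O := by rw [hOW]; exact hqW
    exact this
  obtain ⟨_, ⟨h, rfl⟩, hqh, hhO⟩ := PrimeSpectrum.isTopologicalBasis_basic_opens.exists_subset_of_mem_open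
    hqO (hO.preimage hj.continuous)
  have hh : Ideal.Quotient.mk P.asIdeal h ≠ 0 := fun e ↦
    hqh (hPq (Ideal.Quotient.eq_zero_iff_mem.mp e))
  let R' := Localization.Away (Ideal.Quotient.mk P.asIdeal h)
  let c : PrimeSpectrum R' → PrimeSpectrum R := PrimeSpectrum.comap (Ideal.Quotient.mk P.asIdeal) ∘
    PrimeSpectrum.comap (algebraMap (R ⧸ P.asIdeal) R')
  have hc : Topology.IsInducing c :=
    (PrimeSpectrum.isClosedEmbedding_comap_of_surjective _ _
      Ideal.Quotient.mk_surjective).isInducing.comp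
      (PrimeSpectrum.localization_away_isOpenEmbedding R' (Ideal.Quotient.mk P.asIdeal h)).isInducing
  have hPc : ∀ x, P ≤ c x := fun x a ha ↦ by
    change algebraMap _ R' (Ideal.Quotient.mk P.asIdeal a) ∈ x.asIdeal
    rw [Ideal.Quotient.eq_zero_iff_mem.mpr ha, map_zero]
    exact zero_mem _
  have hcO : ∀ x, j (c x) ∈ O := fun x ↦ hhO fun hmem ↦ x.2.ne_top
    (Ideal.eq_top_of_isUnit_mem _ hmem (IsLocalization.Away.algebraMap_isUnit _))
  let F : PrimeSpectrum R' → W := fun x ↦ ⟨⟨j (c x), hP _ (hPc x)⟩, by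
    change _ ∈ W.1
    rw [← hOW]
    exact hcO x⟩
  have hF : Topology.IsInducing F :=
    ((Topology.IsInducing.subtypeVal.comp Topology.IsInducing.subtypeVal).of_comp_iff).mp
      (hj.isInducing.comp hc)
  rw [← ringKrullDim_away k (R ⧸ P.asIdeal) R' hh, ← PrimeSpectrum.topologicalKrullDim_eq_ringKrullDim]
  exact hF.topologicalKrullDim_le

end LocalDim

/-! ### Reduction to the affine case -/

section Geometry

variable {X S : Scheme.{u}} {f : X ⟶ S}

theorem mem_totalBranchLocus_iff_of_isPullback (s : S) {R A : Type u} [CommRing R] [CommRing A]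
    [Algebra R A] {a : Spec (.of A) ⟶ X} {j : Spec (.of R) ⟶ S}
    (h : IsPullback a (Spec.map (CommRingCat.ofHom (algebraMap R A))) f j)
    [Algebra R (AlgebraicClosure (S.residueField s))]
    (hs : Spec.map (CommRingCat.ofHom (algebraMap R (AlgebraicClosure (S.residueField s)))) ≫ j =
      geometricPoint S s) :
    s ∈ totalBranchLocus f ↔
      ∃ x : PrimeSpectrum (AlgebraicClosure (S.residueField s) ⊗[R] A), ∀ y, y = x := by
  have h' := (isPullback_SpecMap_of_isPushout _ _ _ _ (CommRingCat.isPushout_tensorProduct R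
    (AlgebraicClosure (S.residueField s)) A)).flip.paste_horiz h
  rw [hs] at h'
  let e := Scheme.homeoOfIso h'.isoPullback
  refine ⟨fun ⟨x, hx⟩ ↦ ⟨e.symm x, fun y ↦ ?_⟩, fun ⟨x, hx⟩ ↦ ⟨e x, fun y ↦ ?_⟩⟩
  · exact e.injective ((hx (e y)).trans (e.apply_symm_apply x).symm)
  · exact e.symm.injective ((hx (e.symm y)).trans (e.symm_apply_apply x).symm)

theorem geometricPoint_apply (s : S)
    (x : Spec (CommRingCat.of (AlgebraicClosure (S.residueField s)))) : geometricPoint S s x = s := by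
  rw [geometricPoint, Scheme.Hom.comp_apply]
  exact Scheme.fromSpecResidueField_apply _ _

theorem isTotalBranchLocus_preimage {R A : Type u} [CommRing R] [CommRing A]
    [Algebra R A] {a : Spec (.of A) ⟶ X} {j : Spec (.of R) ⟶ S} [IsOpenImmersion j]
    (h : IsPullback a (Spec.map (CommRingCat.ofHom (algebraMap R A))) f j) :
    IsTotalBranchLocus R A (j ⁻¹' totalBranchLocus f) := by
  intro q
  let Ω := AlgebraicClosure (S.residueField (j q))
  have hpt : ∀ x, geometricPoint S (j q) x = j q := geometricPoint_apply (j q)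
  let ψ' : Spec (.of Ω) ⟶ Spec (.of R) := IsOpenImmersion.lift j (geometricPoint S (j q)) (by
    rintro _ ⟨x, rfl⟩
    exact ⟨q, (hpt x).symm⟩)
  have hψ' : ψ' ≫ j = geometricPoint S (j q) := IsOpenImmersion.lift_fac _ _ _
  let : Algebra R Ω := (Spec.preimage ψ').hom.toAlgebra
  have hψ : Spec.map (CommRingCat.ofHom (algebraMap R Ω)) = ψ' := Spec.map_preimage ψ'
  refine ⟨Ω, inferInstance, inferInstance, inferInstance, ?_,
    mem_totalBranchLocus_iff_of_isPullback (j q) h (hψ.symm ▸ hψ')⟩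
  have h1 : ψ' (⊥ : PrimeSpectrum Ω) = q := by
    refine j.isOpenEmbedding.injective ?_
    have h2 : (ψ' ≫ j) (⊥ : PrimeSpectrum Ω) = j q := by
      rw [hψ']
      exact hpt _
    exact h2
  rw [← hψ] at h1
  exact (RingHom.ker_eq_comap_bot _).trans (congrArg PrimeSpectrum.asIdeal h1)

/-- Every point of the base has an affine open neighbourhood `Spec R` over which `f` is given by a
finite flat `R`-algebra of rank `d`. -/
theorem exists_isPullback_SpecMap {k : Type u} [Field k] (p : S ⟶ Spec (CommRingCat.of k))
    [LocallyOfFiniteType p] [IsFinite f] [Flat f] {d : ℕ} (hd : ∀ s : S, f.finrank s = d) (z : S) :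
    ∃ (R A : Type u) (_ : CommRing R) (_ : CommRing A) (_ : Algebra k R) (_ : Algebra R A)
      (a : Spec (.of A) ⟶ X) (j : Spec (.of R) ⟶ S) (q : PrimeSpectrum R), Algebra.FiniteType k R ∧
      Module.Finite R A ∧ Module.Flat R A ∧
      (∀ x : PrimeSpectrum R, Module.rankAtStalk A x = d) ∧ IsOpenImmersion j ∧ j q = z ∧
      IsPullback a (Spec.map (CommRingCat.ofHom (algebraMap R A))) f j := by
  obtain ⟨R, j, hj, q, hq⟩ := S.exists_Spec_apply_eq z
  let X' := pullback f j
  have : IsAffine X' := isAffine_of_isAffineHom (pullback.snd f j)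
  let A := Γ(X', ⊤)
  let φ : R ⟶ A := Spec.preimage (X'.isoSpec.inv ≫ pullback.snd f j)
  have hφ : Spec.map φ = X'.isoSpec.inv ≫ pullback.snd f j := Spec.map_preimage _
  let : Algebra R A := φ.hom.toAlgebra
  let θ : CommRingCat.of k ⟶ R := Spec.preimage (j ≫ p)
  have hθ : Spec.map θ = j ≫ p := Spec.map_preimage _
  let : Algebra k R := θ.hom.toAlgebra
  have hpb : IsPullback (X'.isoSpec.inv ≫ pullback.fst f j) (Spec.map φ) f j :=
    (IsPullback.of_hasPullback f j).of_iso X'.isoSpec (Iso.refl _) (Iso.refl _) (Iso.refl _)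
      (by simp) (by simp [hφ]) (by simp) (by simp)
  have hfin : φ.hom.Finite := by
    rw [← IsFinite.SpecMap_iff, hφ]
    infer_instance
  have hflat : φ.hom.Flat := by
    rw [← Flat.SpecMap_iff, hφ]
    infer_instance
  have : Module.Finite R A := hfin
  have : Module.Flat R A := hflat
  refine ⟨R, A, inferInstance, inferInstance, inferInstance, inferInstance, _, j, q, ?_,
    hfin, hflat, fun x ↦ ?_, hj, hq, hpb⟩
  · have : LocallyOfFiniteType (Spec.map θ) := by
      rw [hθ]
      infer_instance
    exact (HasRingHomProperty.Spec_iff (P := @LocallyOfFiniteType)).mp this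
  · rw [← Scheme.Hom.finrank_SpecMap_algebraMap R A x]
    exact (Scheme.Hom.finrank_of_isPullback _ _ f j hpb x).trans (hd _)

end Geometry

theorem proposition3p1 {k : Type u} [Field k] [IsAlgClosed k] [CharZero k]
    {X S : Scheme.{u}} (p : S ⟶ Spec (CommRingCat.of k)) [LocallyOfFiniteType p]
    (f : X ⟶ S) [IsFinite f] [Flat f] (d : ℕ) (hd : ∀ s : S, f.finrank s = d)
    (hf : GenericallyEtale f) :
    IsClosed (totalBranchLocus f) ∧
      ∀ z : totalBranchLocus f,
        localDim S (z : S) + 1 ≤ localDim (totalBranchLocus f) z + (d : WithBot ℕ∞) := by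
  constructor
  · rw [← isOpen_compl_iff, isOpen_iff_forall_mem_open]
    intro z hz
    obtain ⟨R, A, _, _, _, _, a, j, q, _, _, _, hrank, _, rfl, hpb⟩ :=
      exists_isPullback_SpecMap p hd z
    have : IsNoetherianRing R := Algebra.FiniteType.isNoetherianRing k R
    have hcl := (isTotalBranchLocus_preimage hpb).isClosed hrank
    refine ⟨j '' (j ⁻¹' totalBranchLocus f)ᶜ, ?_,
      j.isOpenEmbedding.isOpenMap _ hcl.isOpen_compl, ⟨q, hz, rfl⟩⟩
    rintro _ ⟨x, hx, rfl⟩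
    exact hx
  · rintro ⟨z, hz⟩
    obtain ⟨R, A, _, _, _, _, a, j, q, _, _, _, hrank, _, rfl, hpb⟩ :=
      exists_isPullback_SpecMap p hd z
    have : IsNoetherianRing R := Algebra.FiniteType.isNoetherianRing k R
    have hZ := isTotalBranchLocus_preimage hpb
    obtain ⟨p₀, hp₀, hp₀q, hdim⟩ := exists_localDim_le_ringKrullDim_quotient j.isOpenEmbedding q
    obtain ⟨P, hPZ, hPq, hP⟩ := hZ.exists_mem_ringKrullDim_le k hrank p₀ hp₀q hz
    have hPj : ∀ x, P ≤ x → j x ∈ totalBranchLocus f := fun x hx ↦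
      (hZ.isClosed hrank).stableUnderSpecialization ((PrimeSpectrum.le_iff_specializes _ _).mp hx) hPZ
    have hle := ringKrullDim_quotient_le_localDim k j.isOpenEmbedding hPq hPj
    calc localDim S (j q) + 1 ≤ ringKrullDim (R ⧸ p₀) + 1 := by gcongr
      _ ≤ ringKrullDim (R ⧸ P.asIdeal) + d := hP
      _ ≤ _ := by gcongr
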